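/- Let $\nu\in\mathbb C\setminus\{0,-1,-2,\dots\}$, let $z\in\mathbb C\setminus(-\infty,1]$ lie on an ellipse with foci $\pm1$, and let $x\in\mathbb C$ lie in the interior of that ellipse. Then $$\frac{1}{(z-x)^{\nu}}=\sqrt{\frac{2}{\pi}}\;\frac{e^{-i\pi(\nu-1/2)}\,(z^2-1)^{-\nu/2+1/4}}{\Gamma(\nu)}\sum_{n=0}^\infty \epsilon_n\,T_n(x)\,Q_{n-1/2}^{\nu-1/2}(z),$$ where the series converges (absolutely). In particular, for $\nu=1/2$ one has Heine's reciprocal square-root identity $$\frac{1}{\sqrt{z-x}}=\frac{\sqrt2}{\pi}\sum_{n=0}^\infty\epsilon_n\,T_n(x)\,Q_{n-1/2}(z),\qquad Q_{n-1/2}:=Q_{n-1/2}^{0}.$$ Here $T_n$ is the Chebyshev polynomial of the first kind, $\epsilon_0=1$ and $\epsilon_n=2$ for $n\ge1$, and $Q_\alpha^\beta:\mathbb C\setminus(-\infty,1]\to\mathbb C$ is the associated Legendre function of the second kind, that is, the analytic continuation to $\mathbb C\setminus(-\infty,1]$ of $$Q_\alpha^\beta(z)=\frac{\sqrt\pi\,e^{i\pi\beta}\,\Gamma(\alpha+\beta+1)\,(z^2-1)^{\beta/2}}{2^{\alpha+1}\,\Gamma(\alpha+\tfrac32)\,z^{\alpha+\beta+1}}\;{}_2F_1\!\left(\frac{\alpha+\beta+2}{2},\frac{\alpha+\beta+1}{2};\alpha+\frac32;\frac1{z^2}\right),\qquad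 |z|>1 .$$ Powers of $z$ are principal, $(z^2-1)^{s}$ denotes $(z-1)^{s}(z+1)^{s}$ with principal powers, and for fixed $z$ the function $x\mapsto(z-x)^{-\nu}$ is the branch, analytic in the interior of the ellipse, that is the principal power for $x\in[-1,1]$. -/

import Mathlib

noncomputable section

/-- The slit plane `ℂ \ (-∞, 1]`. -/
def cutPlane : Set ℂ := {z : ℂ | ¬ (z.im = 0 ∧ z.re ≤ 1)}

/-- `(z ^ 2 - 1) ^ s` on `ℂ \ (-∞, 1]`: the analytic branch that is positive-valued for `z > 1`
and real `s`, which is the product `(z - 1) ^ s (z + 1) ^ s` of principal powers. -/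
def sqSubOnePow (z s : ℂ) : ℂ := (z - 1) ^ s * (z + 1) ^ s

/-- The hypergeometric expression for the associated Legendre function of the second kind
`Q_ν^μ(z)`, for `z ∈ ℂ \ (-∞, 1]` with `|z| > 1`, where `₂F₁` is given by its power series. -/
def legendreQFormula (ν μ z : ℂ) : ℂ :=
  ((Real.sqrt Real.pi : ℝ) : ℂ) * Complex.exp (Complex.I * Real.pi * μ) *
      Complex.Gamma (ν + μ + 1) * sqSubOnePow z (μ / 2) /
    (2 ^ (ν + 1) * Complex.Gamma (ν + 3 / 2) * z ^ (ν + μ + 1)) *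
    ordinaryHypergeometric ((ν + μ + 2) / 2) ((ν + μ + 1) / 2) (ν + 3 / 2) (1 / z ^ 2)

/-- `f` is an analytic continuation to `ℂ \ (-∞, 1]` of the hypergeometric expression. -/
def IsLegendreQ (ν μ : ℂ) (f : ℂ → ℂ) : Prop :=
  DifferentiableOn ℂ f cutPlane ∧ ∀ z ∈ cutPlane, 1 < ‖z‖ → f z = legendreQFormula ν μ z

open Classical in
/-- The associated Legendre function of the second kind `Q_ν^μ` on `ℂ \ (-∞, 1]` (degree `ν`,
order `μ`): the hypergeometric expression where `|z| > 1`, continued analytically. -/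
def legendreQ (ν μ z : ℂ) : ℂ :=
  if h : ∃ f : ℂ → ℂ, IsLegendreQ ν μ f then h.choose z else legendreQFormula ν μ z

/-- The ellipse with foci `±1` whose major semi-axis is `a > 1`. -/
def confocalEllipse (a : ℝ) : Set ℂ := {w : ℂ | ‖w - 1‖ + ‖w + 1‖ = 2 * a}

/-- The interior of the ellipse with foci `±1` and major semi-axis `a`. -/
def confocalEllipseInterior (a : ℝ) : Set ℂ := {w : ℂ | ‖w - 1‖ + ‖w + 1‖ < 2 * a}

/-- `(z - x) ^ s`, for `z ∈ ℂ \ (-∞, 1]` and `x` inside the ellipse with foci `±1` through `z`: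
the branch that is analytic in `x` there and is the principal power for `x ∈ [-1, 1]`. It is
`z ^ s (1 - x / z) ^ s` with principal powers; see `differentiableOn_subPow` and
`subPow_ofReal`. -/
def subPow (z x s : ℂ) : ℂ := z ^ s * (1 - x / z) ^ s

/-- The Neumann factor `ε_n = 2 - δ_{n,0}`. -/
def neumannFactor (n : ℕ) : ℂ := if n = 0 then 1 else 2

theorem cutPlane_eq : cutPlane = {z : ℂ | z - 1 ∈ Complex.slitPlane} := by
  ext z
  simp only [cutPlane, Set.mem_ofPred_eq, Complex.mem_slitPlane_iff, Complex.sub_re, Complex.sub_im,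
    Complex.one_re, Complex.one_im, sub_pos, sub_zero]
  by_cases h : z.im = 0 <;> simp [h]

theorem isOpen_cutPlane : IsOpen cutPlane := by
  rw [cutPlane_eq]
  exact Complex.isOpen_slitPlane.preimage (by fun_prop)

theorem isPreconnected_cutPlane : IsPreconnected cutPlane := by
  have h : cutPlane = (fun w : ℂ => w + 1) '' Complex.slitPlane := by
    rw [cutPlane_eq]
    ext z
    constructor
    · intro hz
      exact ⟨z - 1, hz, by ring⟩
    · rintro ⟨w, hw, rfl⟩
      simpa using hw
  rw [h]
  refine IsPreconnected.image ?_ _ (by fun_prop)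
  exact (Complex.starConvex_one_slitPlane.isPathConnected
    Complex.one_mem_slitPlane).isConnected.isPreconnected

/-- The continuation is unique, so `legendreQ` is the continuation. -/
theorem IsLegendreQ.legendreQ_eq {ν μ : ℂ} {f : ℂ → ℂ} (hf : IsLegendreQ ν μ f) {z : ℂ}
    (hz : z ∈ cutPlane) : legendreQ ν μ z = f z := by
  have h : ∃ f : ℂ → ℂ, IsLegendreQ ν μ f := ⟨f, hf⟩
  have hg := h.choose_spec
  rw [legendreQ, dif_pos h]
  have h2 : (2 : ℂ) ∈ cutPlane := by simp [cutPlane]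
  refine (hg.1.analyticOnNhd isOpen_cutPlane).eqOn_of_preconnected_of_eventuallyEq
    (hf.1.analyticOnNhd isOpen_cutPlane) isPreconnected_cutPlane h2 ?_ hz
  have h3 : ∀ᶠ w : ℂ in nhds 2, 1 < ‖w‖ :=
    (continuous_norm.tendsto (2 : ℂ)).eventually (lt_mem_nhds (by simp))
  filter_upwards [isOpen_cutPlane.mem_nhds h2, h3] with w hw hw1
  rw [hg.2 w hw hw1, hf.2 w hw hw1]

/-- Where `|z| > 1`, `legendreQ` is given by the hypergeometric expression. -/
theorem legendreQ_of_one_lt_norm {ν μ z : ℂ} (hz : z ∈ cutPlane) (h1 : 1 < ‖z‖) :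
    legendreQ ν μ z = legendreQFormula ν μ z := by
  by_cases h : ∃ f : ℂ → ℂ, IsLegendreQ ν μ f
  · obtain ⟨f, hf⟩ := h
    rw [hf.legendreQ_eq hz, hf.2 z hz h1]
  · rw [legendreQ, dif_neg h]

theorem ne_zero_of_mem_cutPlane {z : ℂ} (hz : z ∈ cutPlane) : z ≠ 0 := by
  rintro rfl
  exact hz (by norm_num)

/-- `subPow z x s` is analytic in `x` inside the ellipse with foci `±1` through `z`. -/
theorem differentiableOn_subPow {a : ℝ} {z : ℂ} (hz : z ∈ cutPlane) (hza : z ∈ confocalEllipse a)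
    (s : ℂ) : DifferentiableOn ℂ (fun x => subPow z x s) (confocalEllipseInterior a) := by
  have h0 := ne_zero_of_mem_cutPlane hz
  intro x hx
  have hs : 1 - x / z ∈ Complex.slitPlane := by
    by_contra hc
    obtain ⟨t, ht, hxt⟩ : ∃ t : ℝ, 1 ≤ t ∧ x = t * z := by
      rw [Complex.mem_slitPlane_iff, not_or, not_lt, not_not] at hc
      refine ⟨(x / z).re, by simpa using hc.1, ?_⟩
      have him : (x / z).im = 0 := by simpa using hc.2
      have : (((x / z).re : ℝ) : ℂ) = x / z := by
        apply Complex.ext <;> simp [him]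
      rw [this, div_mul_cancel₀ _ h0]
    have hx' : ‖x - 1‖ + ‖x + 1‖ < 2 * a := hx
    have hz' : ‖z - 1‖ + ‖z + 1‖ = 2 * a := hza
    have ht0 : (t : ℂ) ≠ 0 := by
      exact_mod_cast (by linarith : t ≠ 0)
    obtain ⟨u, hu0, hu1, hzu⟩ : ∃ u : ℝ, 0 ≤ u ∧ u ≤ 1 ∧ z = u * x := by
      refine ⟨t⁻¹, by positivity, inv_le_one_of_one_le₀ ht, ?_⟩
      rw [hxt]
      push_cast
      field_simp
    have e1 : ‖z - 1‖ ≤ (1 + u) / 2 * ‖x - 1‖ + (1 - u) / 2 * ‖x + 1‖ := by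
      have h : z - 1 = (((1 + u) / 2 : ℝ) : ℂ) * (x - 1) - (((1 - u) / 2 : ℝ) : ℂ) * (x + 1) := by
        rw [hzu]; push_cast; ring
      rw [h]
      refine (norm_sub_le _ _).trans (le_of_eq ?_)
      rw [norm_mul, norm_mul, Complex.norm_of_nonneg (by linarith),
        Complex.norm_of_nonneg (by linarith)]
    have e2 : ‖z + 1‖ ≤ (1 + u) / 2 * ‖x + 1‖ + (1 - u) / 2 * ‖x - 1‖ := by
      have h : z + 1 = (((1 + u) / 2 : ℝ) : ℂ) * (x + 1) - (((1 - u) / 2 : ℝ) : ℂ) * (x - 1) := by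
        rw [hzu]; push_cast; ring
      rw [h]
      refine (norm_sub_le _ _).trans (le_of_eq ?_)
      rw [norm_mul, norm_mul, Complex.norm_of_nonneg (by linarith),
        Complex.norm_of_nonneg (by linarith)]
    linarith
  refine DifferentiableAt.differentiableWithinAt ?_
  unfold subPow
  refine DifferentiableAt.const_mul ?_ _
  exact DifferentiableAt.cpow (by fun_prop) (by fun_prop) hs

/-- `subPow z x s` is the principal power `(z - x) ^ s` for `x ∈ [-1, 1]`. -/
theorem subPow_ofReal {z : ℂ} (hz : z ∈ cutPlane) {x : ℝ} (hx : x ∈ Set.Icc (-1 : ℝ) 1) (s : ℂ) :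
    subPow z x s = (z - x) ^ s := by
  have h0 := ne_zero_of_mem_cutPlane hz
  have hw : z - x ∈ Complex.slitPlane := by
    rw [Complex.mem_slitPlane_iff]
    by_cases h : z.im = 0
    · left
      have : ¬ z.re ≤ 1 := fun h' => hz ⟨h, h'⟩
      simp only [Complex.sub_re, Complex.ofReal_re]
      linarith [hx.2]
    · right
      simpa using h
  have hzs : z ∈ Complex.slitPlane := by
    rw [Complex.mem_slitPlane_iff]
    by_cases h : z.im = 0
    · left
      have : ¬ z.re ≤ 1 := fun h' => hz ⟨h, h'⟩
      linarith
    · exact Or.inr h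
  have hw0 := Complex.slitPlane_ne_zero hw
  have hq : 1 - (x : ℂ) / z = (z - x) * z⁻¹ := by
    field_simp
  have hargz := Complex.mem_slitPlane_iff_arg.1 hzs
  have hargw := Complex.mem_slitPlane_iff_arg.1 hw
  have him : (z - x).im = z.im := by simp
  have hlog : Complex.log ((z - x) * z⁻¹) = Complex.log (z - x) + Complex.log z⁻¹ := by
    refine (Complex.log_mul_eq_add_log_iff hw0 (inv_ne_zero h0)).2 ?_
    rw [Complex.arg_inv, if_neg hargz.1]
    have a1 := Complex.arg_le_pi z
    have a2 := Complex.neg_pi_lt_arg z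
    have b1 := Complex.arg_le_pi (z - x)
    have b2 := Complex.neg_pi_lt_arg (z - x)
    have c1 : z.arg < Real.pi := lt_of_le_of_ne a1 hargz.1
    have c2 : (z - x).arg < Real.pi := lt_of_le_of_ne b1 hargw.1
    rcases lt_or_ge z.im 0 with h | h
    · have d1 := Complex.arg_neg_iff.2 h
      have d2 := Complex.arg_neg_iff.2 (him.symm ▸ h)
      constructor <;> linarith
    · have d1 := Complex.arg_nonneg_iff.2 h
      have d2 := Complex.arg_nonneg_iff.2 (him.symm ▸ h)
      constructor <;> linarith
  rw [subPow, hq, Complex.cpow_def_of_ne_zero h0,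
    Complex.cpow_def_of_ne_zero (mul_ne_zero hw0 (inv_ne_zero h0)),
    Complex.cpow_def_of_ne_zero hw0, ← Complex.exp_add, hlog, Complex.log_inv _ hargz.1]
  congr 1
  ring

end

noncomputable section

open Real Filter Topology MeasureTheory

/-! Put `w = joukowskyInv z`, so that `w + w⁻¹ = 2z` and `|w| > 1`, and write `x = cos θ`. Then `z -
x = (w/2)(1 - e^{iθ}/w)(1 - e^{-iθ}/w)`, and `x` lies inside the ellipse through `z` exactly when
`|Im θ| < log |w|`, that is, when both binomial series of the `(-ν)`-th powers converge absolutely.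
Multiplying them and grouping the terms by the power of `e^{iθ}` gives a cosine series, hence a
Chebyshev series, with coefficients `chebyshevCoeff ν n z` (`hasSum_cos_chebyshevCoeff`).

It remains to recognize these coefficients as Legendre functions. For `|z| > 1` and real `θ`, the
function is also `z^{-ν}(1 - cos θ / z)^{-ν}`; expanding in powers of `cos θ` gives a second cosine
series, whose coefficients are `₂F₁` series in `1/z²`. Uniqueness of cosine coefficients
(`eq_zero_of_hasSum_cos`) equates the two, which proves the needed quadratic transformation. Since
`chebyshevCoeff` is analytic on all of `cutPlane`, a multiple of it is the continuation that defines
`legendreQ` (`isLegendreQ_chebyshevCoeff`).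

Branches of the powers are matched on real `θ` by bounding arguments (`SameSide.cpow_eq_mul`) and
carried to complex `θ` by the identity theorem (`subPow_cos`). -/

/-! ### Taylor coefficients of `(1 - x) ^ (-ν)` -/

/-- The Taylor coefficient `(ν)_k / k!` of `(1 - x) ^ (-ν)`. -/
def negBinomialCoeff (ν : ℂ) (k : ℕ) : ℂ := (ascPochhammer ℂ k).eval ν / (k.factorial : ℂ)

theorem negBinomialCoeff_eq_choose (ν : ℂ) (k : ℕ) :
    negBinomialCoeff ν k = Ring.choose (ν + k - 1) k := by
  have h := Ring.factorial_nsmul_multichoose_eq_ascPochhammer ν k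
  rw [Polynomial.ascPochhammer_smeval_eq_eval, nsmul_eq_mul] at h
  rw [negBinomialCoeff, ← h, mul_div_cancel_left₀ _ (by exact_mod_cast k.factorial_ne_zero),
    Ring.choose]
  congr 1
  ring

theorem hasSum_negBinomialCoeff (ν : ℂ) {x : ℂ} (hx : ‖x‖ < 1) :
    HasSum (fun k => negBinomialCoeff ν k * x ^ k) ((1 - x) ^ (-ν)) := by
  have h := (Complex.one_div_one_sub_cpow_hasFPowerSeriesOnBall_zero ν).hasSum (y := x)
    (by simpa [enorm_eq_nnnorm, ← NNReal.coe_lt_coe] using hx)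
  simpa [FormalMultilinearSeries.ofScalars_apply_eq, negBinomialCoeff_eq_choose,
    Complex.cpow_neg, mul_comm] using h

theorem summable_norm_negBinomialCoeff (ν : ℂ) {x : ℂ} (hx : ‖x‖ < 1) :
    Summable (fun k => ‖negBinomialCoeff ν k * x ^ k‖) :=
  (hasSum_negBinomialCoeff ν hx).summable.norm

/-! ### Symmetric double series as cosine series -/

/-- The pairs `(j, k)` of natural numbers are parametrized by `(j - k, min j k)`. -/
def intProdNatEquiv : ℤ × ℕ ≃ ℕ × ℕ where
  toFun p := (p.1.toNat + p.2, (-p.1).toNat + p.2)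
  invFun p := ((p.1 : ℤ) - p.2, min p.1 p.2)
  left_inv p := by
    ext <;> simp
    omega
  right_inv p := by
    ext <;> simp
    omega

/-- Summing along the lines `j - k = d` leaves an inner sum that depends only on `|d|` by symmetry;
the terms `d` and `-d` then combine into `2 cos (dθ)`. -/
theorem hasSum_cos_of_symmetric {f : ℕ × ℕ → ℂ} (hf : ∀ p, f p.swap = f p) {θ S : ℂ}
    (h : HasSum (fun p : ℕ × ℕ => f p * Complex.exp (((p.1 : ℂ) - p.2) * (θ * Complex.I))) S) :
    HasSum (fun n : ℕ => neumannFactor n * Complex.cos (n * θ) * ∑' k, f (n + k, k)) S := by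
  have key : ∀ (d : ℤ) (k : ℕ), f (intProdNatEquiv (d, k)) *
      Complex.exp ((((intProdNatEquiv (d, k)).1 : ℂ) - (intProdNatEquiv (d, k)).2) *
        (θ * Complex.I)) = f (d.natAbs + k, k) * Complex.exp (d * (θ * Complex.I)) := by
    intro d k
    have e : (((intProdNatEquiv (d, k)).1 : ℂ) - (intProdNatEquiv (d, k)).2) = (d : ℂ) := by
      have : ((intProdNatEquiv (d, k)).1 : ℤ) - (intProdNatEquiv (d, k)).2 = d := by
        simp [intProdNatEquiv]
      exact_mod_cast congrArg (Int.cast : ℤ → ℂ) this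
    rw [e]
    congr 1
    rcases le_total 0 d with hd | hd
    · congr 1
      ext <;> simp [intProdNatEquiv] <;> omega
    · rw [← hf]
      congr 1
      ext <;> simp [intProdNatEquiv] <;> omega
  have h1 := (intProdNatEquiv.hasSum_iff).2 h
  have h2 : HasSum (fun d : ℤ => (∑' k, f (d.natAbs + k, k)) * Complex.exp (d * (θ * Complex.I)))
      S := by
    refine h1.prod_fiberwise fun d => ?_
    have := (h1.summable.prod_factor d).hasSum
    simp only [Function.comp_apply, key] at this ⊢
    rwa [tsum_mul_right] at this
  have h3 := h2.nat_add_neg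
  -- Pairing `d` with `-d` counts `d = 0` twice, so one copy is removed; this is why the Neumann
  -- factor is 1 at `n = 0`.
  have h4 := h3.sub (hasSum_ite_eq (0 : ℕ) (∑' k, f (k, k)))
  have h5 : S + (∑' k, f (Int.natAbs 0 + k, k)) * Complex.exp (((0 : ℤ) : ℂ) * (θ * Complex.I)) -
      ∑' k, f (k, k) = S := by simp
  rw [h5] at h4
  refine h4.congr_fun fun n => ?_
  rcases Nat.eq_zero_or_pos n with rfl | hn
  · simp [neumannFactor]
  · have hn' := hn.ne'
    simp only [neumannFactor, hn', if_false, Complex.cos, Int.natAbs_neg, Int.natAbs_natCast,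
      Int.cast_neg, Int.cast_natCast, sub_zero]
    ring_nf

theorem integral_cos_mul_cos_of_ne {m n : ℕ} (h : n ≠ m) :
    ∫ θ in (0 : ℝ)..π, Complex.cos (n * θ) * Complex.cos (m * θ) = 0 := by
  have key : ∀ k : ℤ, k ≠ 0 → ∫ θ in (0 : ℝ)..π, Complex.cos (k * θ) = 0 := by
    intro k hk
    rw [integral_cos_mul_complex (by exact_mod_cast hk)]
    simp [Complex.sin_int_mul_pi]
  have e : ∀ θ : ℝ, Complex.cos (n * θ) * Complex.cos (m * θ) =
      (1 / 2) * (Complex.cos (((n - m : ℤ) : ℂ) * θ) + Complex.cos (((n + m : ℤ) : ℂ) * θ)) := by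
    intro θ
    push_cast
    rw [sub_mul, add_mul, Complex.cos_sub, Complex.cos_add]
    ring
  simp_rw [e]
  rw [intervalIntegral.integral_const_mul, intervalIntegral.integral_add
    (Continuous.intervalIntegrable (by fun_prop) _ _)
    (Continuous.intervalIntegrable (by fun_prop) _ _), key _ (by omega), key _ (by omega)]
  simp

theorem integral_cos_mul_cos_self_ne_zero (m : ℕ) :
    ∫ θ in (0 : ℝ)..π, Complex.cos (m * θ) * Complex.cos (m * θ) ≠ 0 := by
  have e : ∀ θ : ℝ, Complex.cos (m * θ) * Complex.cos (m * θ) =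
      ((Real.cos (m * θ) ^ 2 : ℝ) : ℂ) := by
    intro θ
    push_cast
    ring
  simp_rw [e]
  rw [intervalIntegral.integral_ofReal]
  norm_cast
  refine (intervalIntegral.integral_pos Real.pi_pos (by fun_prop)
    (fun _ _ => sq_nonneg _) ⟨0, ⟨le_rfl, Real.pi_pos.le⟩, by simp⟩).ne'

/-- Integrating against `cos (mθ)` over `[0, π]` isolates `c m` by orthogonality. -/
theorem eq_zero_of_hasSum_cos {c : ℕ → ℂ}
    (h : ∀ θ : ℝ, HasSum (fun n : ℕ => Complex.cos (n * θ) * c n) 0) (m : ℕ) : c m = 0 := by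
  -- At `θ = 0` every cosine is 1, so the hypothesis itself supplies the dominating series.
  have hc : Summable (fun n => ‖c n‖) := by simpa using (h 0).summable.norm
  have hcos : ∀ (n : ℕ) (θ : ℝ), ‖Complex.cos (n * θ)‖ ≤ 1 := by
    intro n θ
    have : Complex.cos (n * θ) = ((Real.cos (n * θ) : ℝ) : ℂ) := by push_cast; rfl
    rw [this, Complex.norm_real]
    exact Real.abs_cos_le_one _
  have h1 := intervalIntegral.hasSum_integral_of_dominated_convergence (μ := volume) (a := 0)
    (b := π) (F := fun (n : ℕ) (θ : ℝ) => Complex.cos (n * θ) * Complex.cos (m * θ) * c n)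
    (f := fun _ => 0) (fun n _ => ‖c n‖)
    (fun n => Continuous.aestronglyMeasurable (by fun_prop))
    (fun n => ae_of_all _ fun θ _ => by
      rw [norm_mul, norm_mul]
      refine mul_le_of_le_one_left (norm_nonneg _) ?_
      exact mul_le_one₀ (hcos n θ) (norm_nonneg _) (hcos m θ))
    (ae_of_all _ fun _ _ => hc) (by simp)
    (ae_of_all _ fun θ _ => by
      simpa [mul_comm, mul_assoc, mul_left_comm] using (h θ).mul_left (Complex.cos (m * θ)))
  simp only [intervalIntegral.integral_mul_const, intervalIntegral.integral_zero] at h1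
  have h2 := hasSum_single (f := fun n : ℕ =>
    (∫ θ in (0 : ℝ)..π, Complex.cos (n * θ) * Complex.cos (m * θ)) * c n) m
    (fun n hn => by simp only [integral_cos_mul_cos_of_ne hn, zero_mul])
  exact (mul_eq_zero.1 (h2.unique h1)).resolve_left (integral_cos_mul_cos_self_ne_zero m)

/-! ### The inverse Joukowsky map -/

/-- The solution `w` of `w + w⁻¹ = 2 * z` with `1 < ‖w‖`, for `z ∈ ℂ \ (-∞, 1]`. -/
def joukowskyInv (z : ℂ) : ℂ := z + (z - 1) ^ (2⁻¹ : ℂ) * (z + 1) ^ (2⁻¹ : ℂ)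

theorem sub_one_mem_slitPlane {z : ℂ} (hz : z ∈ cutPlane) : z - 1 ∈ Complex.slitPlane := by
  rwa [cutPlane_eq] at hz

theorem sub_ofReal_mem_slitPlane {z : ℂ} (hz : z ∈ cutPlane) {x : ℝ} (hx : x ≤ 1) :
    z - x ∈ Complex.slitPlane := by
  have h := sub_one_mem_slitPlane hz
  rw [Complex.mem_slitPlane_iff] at h ⊢
  refine h.imp (fun h => ?_) (fun h => by simpa using h)
  simp only [Complex.sub_re, Complex.one_re, Complex.ofReal_re] at h ⊢
  linarith

theorem add_one_mem_slitPlane {z : ℂ} (hz : z ∈ cutPlane) : z + 1 ∈ Complex.slitPlane := by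
  simpa using sub_ofReal_mem_slitPlane hz (x := -1) (by norm_num)

theorem cpow_inv_two_re_pos {z : ℂ} (hz : z ∈ Complex.slitPlane) : 0 < (z ^ (2⁻¹ : ℂ)).re := by
  rw [Complex.cpow_inv_two_re]
  refine Real.sqrt_pos.2 (half_pos ?_)
  rcases Complex.mem_slitPlane_iff.1 hz with h | h
  · linarith [norm_nonneg z]
  · linarith [neg_lt_of_abs_lt (Complex.abs_re_lt_norm.2 h)]

/-- The inverse Joukowsky map in terms of square roots `p` of `z - 1` and `q` of `z + 1`. -/
theorem exists_joukowskyInv_eq {z : ℂ} (hz : z ∈ cutPlane) :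
    ∃ p q : ℂ, 0 < p.re ∧ 0 < q.re ∧ p ^ 2 = z - 1 ∧ q ^ 2 = z + 1 ∧
      joukowskyInv z = (q + p) ^ 2 / 2 := by
  have hp : ((z - 1) ^ (2⁻¹ : ℂ)) ^ 2 = z - 1 := Complex.cpow_nat_inv_pow _ two_ne_zero
  have hq : ((z + 1) ^ (2⁻¹ : ℂ)) ^ 2 = z + 1 := Complex.cpow_nat_inv_pow _ two_ne_zero
  refine ⟨_, _, cpow_inv_two_re_pos (sub_one_mem_slitPlane hz),
    cpow_inv_two_re_pos (add_one_mem_slitPlane hz), hp, hq, ?_⟩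
  rw [joukowskyInv]
  linear_combination (-1 / 2) * hp - (1 / 2) * hq

theorem joukowskyInv_ne_zero {z : ℂ} (hz : z ∈ cutPlane) : joukowskyInv z ≠ 0 := by
  obtain ⟨p, q, hp, hq, -, -, hw⟩ := exists_joukowskyInv_eq hz
  rw [hw]
  refine div_ne_zero (pow_ne_zero _ fun h => ?_) two_ne_zero
  have := congrArg Complex.re h
  simp only [Complex.add_re, Complex.zero_re] at this
  linarith

/-- Since `q² - p² = 2`, the product `(q + p)(q - p)` is 2. -/
theorem inv_eq_of_sq {z p q w : ℂ} (hp : p ^ 2 = z - 1) (hq : q ^ 2 = z + 1)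
    (hw : w = (q + p) ^ 2 / 2) : w⁻¹ = (q - p) ^ 2 / 2 := by
  refine inv_eq_of_mul_eq_one_right ?_
  have h : q ^ 2 - p ^ 2 = 2 := by rw [hp, hq]; ring
  rw [hw]
  linear_combination ((q ^ 2 - p ^ 2 + 2) / 4) * h

theorem joukowskyInv_add_inv {z : ℂ} (hz : z ∈ cutPlane) :
    joukowskyInv z + (joukowskyInv z)⁻¹ = 2 * z := by
  obtain ⟨p, q, -, -, hp, hq, hw⟩ := exists_joukowskyInv_eq hz
  rw [inv_eq_of_sq hp hq hw, hw]
  linear_combination hp + hq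

/-- By the parallelogram law for `p` and `q`; thus `|w|` depends only on the confocal ellipse
through `z`. -/
theorem norm_joukowskyInv_add_inv {z : ℂ} (hz : z ∈ cutPlane) :
    ‖joukowskyInv z‖ + ‖joukowskyInv z‖⁻¹ = ‖z - 1‖ + ‖z + 1‖ := by
  obtain ⟨p, q, -, -, hp, hq, hw⟩ := exists_joukowskyInv_eq hz
  rw [← norm_inv, inv_eq_of_sq hp hq hw, hw, ← hp, ← hq]
  simp only [norm_div, norm_pow, Complex.norm_ofNat]
  linarith [parallelogram_law_with_norm ℝ q p]

/-- The inequality `|w⁻¹| < |w|` reads `|q - p| < |q + p|`, i.e. `Re p Re q + Im p Im q > 0`. -/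
theorem one_lt_norm_joukowskyInv {z : ℂ} (hz : z ∈ cutPlane) : 1 < ‖joukowskyInv z‖ := by
  obtain ⟨p, q, hp0, hq0, hp, hq, hw⟩ := exists_joukowskyInv_eq hz
  -- `p²` and `q²` both have imaginary part `Im z`, and the real parts of `p` and `q` are positive.
  have him : 0 ≤ p.im * q.im := by
    have h1 := congrArg Complex.im hp
    have h2 := congrArg Complex.im hq
    simp only [pow_two, Complex.mul_im, Complex.sub_im, Complex.add_im, Complex.one_im, sub_zero,
      add_zero] at h1 h2
    have h3 : p.re * p.im = q.re * q.im := by linarith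
    have h4 : 0 ≤ p.re * (p.im * q.im) := by
      have : p.re * (p.im * q.im) = q.re * (q.im * q.im) := by linear_combination q.im * h3
      rw [this]
      exact mul_nonneg hq0.le (mul_self_nonneg _)
    exact nonneg_of_mul_nonneg_right h4 hp0
  have hlt : ‖(joukowskyInv z)⁻¹‖ < ‖joukowskyInv z‖ := by
    rw [inv_eq_of_sq hp hq hw, hw]
    simp only [norm_div, norm_pow, Complex.norm_ofNat, Complex.sq_norm, Complex.normSq_apply,
      Complex.sub_re, Complex.sub_im, Complex.add_re, Complex.add_im]
    have := mul_pos hp0 hq0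
    linarith
  rw [norm_inv] at hlt
  by_contra! h
  have := (one_le_inv₀ (norm_pos_iff.2 (joukowskyInv_ne_zero hz))).2 h
  linarith

/-- Two numbers lie on the same side of the real axis, or both on its positive half. -/
def SameSide (a b : ℂ) : Prop :=
  (0 < a.im ∧ 0 < b.im) ∨ (a.im < 0 ∧ b.im < 0) ∨ (a.im = 0 ∧ b.im = 0 ∧ 0 < a.re ∧ 0 < b.re)

theorem SameSide.abs_arg_sub_lt {a b : ℂ} (h : SameSide a b) : |a.arg - b.arg| < π := by
  rw [abs_lt]
  have a1 := Complex.arg_le_pi a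
  have a2 := Complex.neg_pi_lt_arg a
  have b1 := Complex.arg_le_pi b
  have b2 := Complex.neg_pi_lt_arg b
  have hπ := Real.pi_pos
  rcases h with ⟨h1, h2⟩ | ⟨h1, h2⟩ | ⟨h1, h2, h3, h4⟩
  · have c1 : 0 < a.arg := (Complex.arg_nonneg_iff.2 h1.le).lt_of_ne fun h =>
      h1.ne' (Complex.arg_eq_zero_iff.1 h.symm).2
    have c2 : 0 < b.arg := (Complex.arg_nonneg_iff.2 h2.le).lt_of_ne fun h =>
      h2.ne' (Complex.arg_eq_zero_iff.1 h.symm).2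
    constructor <;> linarith
  · have c1 := Complex.arg_neg_iff.2 h1
    have c2 := Complex.arg_neg_iff.2 h2
    constructor <;> linarith
  · rw [Complex.arg_eq_zero_iff.2 ⟨h3.le, h1⟩, Complex.arg_eq_zero_iff.2 ⟨h4.le, h2⟩]
    constructor <;> linarith

/-- `Im p` and `Im q` have the sign of `Im z`, hence so does the imaginary part of `(q + p)²`; for
real `z` both roots are real. -/
theorem sameSide_sub_joukowskyInv {z : ℂ} (hz : z ∈ cutPlane) {x : ℝ} (hx : x ≤ 1) :
    SameSide (z - x) (joukowskyInv z / 2) := by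
  obtain ⟨p, q, hp0, hq0, hp, hq, hw⟩ := exists_joukowskyInv_eq hz
  have h1 := congrArg Complex.im hp
  have h2 := congrArg Complex.im hq
  simp only [pow_two, Complex.mul_im, Complex.sub_im, Complex.add_im, Complex.one_im, sub_zero,
      add_zero] at h1 h2
  have him : (joukowskyInv z / 2).im = (q.re + p.re) * (q.im + p.im) / 2 := by
    have : joukowskyInv z / 2 = (q + p) ^ 2 * ((1 / 4 : ℝ) : ℂ) := by rw [hw]; push_cast; ring
    rw [this, Complex.im_mul_ofReal]
    simp [pow_two]
    ring
  have hre : (joukowskyInv z / 2).re =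
      ((q.re + p.re) * (q.re + p.re) - (q.im + p.im) * (q.im + p.im)) / 4 := by
    have : joukowskyInv z / 2 = (q + p) ^ 2 * ((1 / 4 : ℝ) : ℂ) := by rw [hw]; push_cast; ring
    rw [this, Complex.re_mul_ofReal]
    simp [pow_two]
    ring
  have hs := sub_ofReal_mem_slitPlane hz hx
  have hzi : (z - x).im = z.im := by simp
  rw [Complex.mem_slitPlane_iff] at hs
  rw [SameSide, him, hre, hzi]
  rw [hzi] at hs
  rcases lt_trichotomy z.im 0 with h | h | h
  · have c1 : p.im < 0 := by
      by_contra! hc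
      linarith [mul_nonneg hp0.le hc]
    have c2 : q.im < 0 := by
      by_contra! hc
      linarith [mul_nonneg hq0.le hc]
    have := mul_neg_of_pos_of_neg (add_pos hq0 hp0) (add_neg c2 c1)
    exact Or.inr (Or.inl ⟨h, by linarith⟩)
  · have c1 : p.im = 0 := by
      have : p.re * p.im = 0 := by linarith
      exact (mul_eq_zero.1 this).resolve_left hp0.ne'
    have c2 : q.im = 0 := by
      have : q.re * q.im = 0 := by linarith
      exact (mul_eq_zero.1 this).resolve_left hq0.ne'
    refine Or.inr (Or.inr ⟨h, by simp [c1, c2], hs.resolve_right (by simp [h]), ?_⟩)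
    have := mul_pos (add_pos hq0 hp0) (add_pos hq0 hp0)
    simp only [c1, c2]
    linarith
  · have c1 : 0 < p.im := by
      by_contra! hc
      linarith [mul_nonpos_of_nonneg_of_nonpos hp0.le hc]
    have c2 : 0 < q.im := by
      by_contra! hc
      linarith [mul_nonpos_of_nonneg_of_nonpos hq0.le hc]
    have := mul_pos (add_pos hq0 hp0) (add_pos c2 c1)
    exact Or.inl ⟨h, by linarith⟩

theorem joukowskyInv_div_two_mem_slitPlane {z : ℂ} (hz : z ∈ cutPlane) :
    joukowskyInv z / 2 ∈ Complex.slitPlane := by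
  rw [Complex.mem_slitPlane_iff]
  rcases sameSide_sub_joukowskyInv hz le_rfl with h | h | h
  · exact Or.inr h.2.ne'
  · exact Or.inr h.2.ne
  · exact Or.inl h.2.2.2

theorem differentiableOn_joukowskyInv : DifferentiableOn ℂ joukowskyInv cutPlane := by
  intro z hz
  refine DifferentiableAt.differentiableWithinAt ?_
  refine DifferentiableAt.add differentiableAt_id (DifferentiableAt.mul ?_ ?_)
  · exact DifferentiableAt.cpow (by fun_prop) (by fun_prop) (sub_one_mem_slitPlane hz)
  · exact DifferentiableAt.cpow (by fun_prop) (by fun_prop) (add_one_mem_slitPlane hz)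

/-- The logarithms of the two sides of `e` differ by `2πin`. The arguments of `a` and `b` differ by
less than `π`, and those of `c` and `d` are below `π/2` in modulus, so `|2πn| < 2π` and `n = 0`. -/
theorem SameSide.cpow_eq_mul {a b c d : ℂ} (h : SameSide a b) (hb : b ≠ 0) (hc : 0 < c.re)
    (hd : 0 < d.re) (e : a = b * (c * d)) (s : ℂ) : a ^ s = b ^ s * (c ^ s * d ^ s) := by
  have hc0 : c ≠ 0 := by rintro rfl; simp at hc
  have hd0 : d ≠ 0 := by rintro rfl; simp at hd
  have ha : a ≠ 0 := by rw [e]; exact mul_ne_zero hb (mul_ne_zero hc0 hd0)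
  have hexp : Complex.exp (Complex.log a) =
      Complex.exp (Complex.log b + (Complex.log c + Complex.log d)) := by
    rw [Complex.exp_add, Complex.exp_add, Complex.exp_log ha, Complex.exp_log hb,
      Complex.exp_log hc0, Complex.exp_log hd0, e]
  obtain ⟨n, hn⟩ := Complex.exp_eq_exp_iff_exists_int.1 hexp
  have him := congrArg Complex.im hn
  have e1 : ((n : ℂ) * (2 * π * Complex.I)).im = n * (2 * π) := by
    simp
  simp only [Complex.add_im, Complex.log_im, e1] at him
  have h1 := abs_lt.1 h.abs_arg_sub_lt
  have h2 := abs_lt.1 (Complex.abs_arg_lt_pi_div_two_iff.2 (Or.inl hc))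
  have h3 := abs_lt.1 (Complex.abs_arg_lt_pi_div_two_iff.2 (Or.inl hd))
  have hn0 : n = 0 := by
    have hπ := Real.pi_pos
    have u1 : (n : ℝ) < 1 := by
      by_contra! hc
      nlinarith
    have u2 : (-1 : ℝ) < n := by
      by_contra! hc
      nlinarith
    have u1' : n < 1 := by exact_mod_cast u1
    have u2' : -1 < n := by exact_mod_cast u2
    omega
  rw [hn0] at hn
  rw [Complex.cpow_def_of_ne_zero ha, Complex.cpow_def_of_ne_zero hb,
    Complex.cpow_def_of_ne_zero hc0, Complex.cpow_def_of_ne_zero hd0, hn, ← Complex.exp_add,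
    ← Complex.exp_add]
  congr 1
  push_cast
  ring

/-! ### Confocal ellipses -/

/-- With `s = e^{iθ/2}` and `t = s⁻¹`, `cos θ ∓ 1 = (s ∓ t)²/2`, and the parallelogram law applies.
-/
theorem norm_cos_sub_one_add_norm_cos_add_one (θ : ℂ) :
    ‖Complex.cos θ - 1‖ + ‖Complex.cos θ + 1‖ = 2 * Real.cosh θ.im := by
  set s := Complex.exp (θ / 2 * Complex.I) with hs
  set t := Complex.exp (-(θ / 2) * Complex.I) with ht
  have hst : s * t = 1 := by
    rw [hs, ht, ← Complex.exp_add, ← Complex.exp_zero]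
    congr 1
    ring
  have hs2 : s ^ 2 = Complex.exp (θ * Complex.I) := by
    rw [hs, ← Complex.exp_nat_mul]
    congr 1
    push_cast
    ring
  have ht2 : t ^ 2 = Complex.exp (-θ * Complex.I) := by
    rw [ht, ← Complex.exp_nat_mul]
    congr 1
    push_cast
    ring
  have e1 : Complex.cos θ - 1 = (s - t) ^ 2 / 2 := by
    rw [Complex.cos, ← hs2, ← ht2]
    linear_combination hst
  have e2 : Complex.cos θ + 1 = (s + t) ^ 2 / 2 := by
    rw [Complex.cos, ← hs2, ← ht2]
    linear_combination -hst
  have n1 : ‖s‖ ^ 2 = Real.exp (-θ.im) := by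
    rw [← norm_pow, hs2, Complex.norm_exp]
    simp
  have n2 : ‖t‖ ^ 2 = Real.exp θ.im := by
    rw [← norm_pow, ht2, Complex.norm_exp]
    simp
  rw [e1, e2, Real.cosh_eq, ← n1, ← n2]
  simp only [norm_div, norm_pow, Complex.norm_ofNat]
  linarith [parallelogram_law_with_norm ℝ s t]

/-- Both sums of focal distances are hyperbolic cosines, of `Im θ` and of `log |w|`, each doubled.
-/
theorem cos_mem_confocalEllipseInterior_iff {a : ℝ} {z θ : ℂ} (hz : z ∈ cutPlane)
    (hza : z ∈ confocalEllipse a) :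
    Complex.cos θ ∈ confocalEllipseInterior a ↔ |θ.im| < Real.log ‖joukowskyInv z‖ := by
  have h1 := one_lt_norm_joukowskyInv hz
  have h2 : ‖z - 1‖ + ‖z + 1‖ = 2 * a := hza
  have h3 := Real.cosh_log (zero_lt_one.trans h1)
  have h4 := norm_joukowskyInv_add_inv hz
  have h5 := Real.log_pos h1
  rw [← abs_of_pos h5, ← Real.cosh_lt_cosh, h3, h4, h2]
  rw [confocalEllipseInterior, Set.mem_ofPred_eq, norm_cos_sub_one_add_norm_cos_add_one]
  constructor <;> intro h <;> linarith

/-! ### The Chebyshev coefficients of `(z - x) ^ (-ν)` -/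

/-- The coefficient of `ε_n T_n(x)` in the Chebyshev expansion of `(z - x) ^ (-ν)`. -/
def chebyshevCoeff (ν : ℂ) (n : ℕ) (z : ℂ) : ℂ :=
  ∑' k, (joukowskyInv z / 2) ^ (-ν) *
    (negBinomialCoeff ν (n + k) * negBinomialCoeff ν k * (joukowskyInv z)⁻¹ ^ (n + k + k))

theorem norm_exp_mul_I (θ : ℂ) : ‖Complex.exp (θ * Complex.I)‖ = Real.exp (-θ.im) := by
  rw [Complex.norm_exp]
  simp

theorem norm_exp_mul_I_div_lt_one {θ w : ℂ} (hw : 1 < ‖w‖) (h : |θ.im| < Real.log ‖w‖) :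
    ‖Complex.exp (θ * Complex.I) / w‖ < 1 := by
  have h0 := zero_lt_one.trans hw
  rw [norm_div, norm_exp_mul_I, div_lt_one h0, ← Real.lt_log_iff_exp_lt h0]
  linarith [(abs_lt.1 h).1]

theorem exp_mul_exp_mul_I (j k : ℕ) (θ : ℂ) :
    Complex.exp (θ * Complex.I) ^ j * Complex.exp (-θ * Complex.I) ^ k =
      Complex.exp (((j : ℂ) - k) * (θ * Complex.I)) := by
  rw [← Complex.exp_nat_mul, ← Complex.exp_nat_mul, ← Complex.exp_add]
  congr 1
  ring

theorem hasSum_cos_chebyshevCoeff_aux (ν : ℂ) {z θ : ℂ} (hz : z ∈ cutPlane)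
    (h : |θ.im| < Real.log ‖joukowskyInv z‖) :
    HasSum (fun n : ℕ => neumannFactor n * Complex.cos (n * θ) * chebyshevCoeff ν n z)
      ((joukowskyInv z / 2) ^ (-ν) * ((1 - Complex.exp (θ * Complex.I) / joukowskyInv z) ^ (-ν) *
        (1 - Complex.exp (-θ * Complex.I) / joukowskyInv z) ^ (-ν))) := by
  have h1 := one_lt_norm_joukowskyInv hz
  set w := joukowskyInv z with hw
  have c1 := norm_exp_mul_I_div_lt_one h1 h
  have c2 : ‖Complex.exp (-θ * Complex.I) / w‖ < 1 :=
    norm_exp_mul_I_div_lt_one h1 (by simpa using h)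
  refine hasSum_cos_of_symmetric (f := fun p => (w / 2) ^ (-ν) *
    (negBinomialCoeff ν p.1 * negBinomialCoeff ν p.2 * w⁻¹ ^ (p.1 + p.2))) ?_ ?_
  · rintro ⟨j, k⟩
    simp only [Prod.swap]
    rw [add_comm k j]
    ring
  · have hs := summable_mul_of_summable_norm (summable_norm_negBinomialCoeff ν c1)
        (summable_norm_negBinomialCoeff ν c2)
    have h2 := ((hasSum_negBinomialCoeff ν c1).mul
      (hasSum_negBinomialCoeff ν c2) hs).mul_left ((w / 2) ^ (-ν))
    refine h2.congr_fun fun p => ?_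
    rw [← exp_mul_exp_mul_I]
    simp only [div_eq_mul_inv, mul_pow, pow_add]
    ring

theorem one_sub_re_pos {x : ℂ} (hx : ‖x‖ < 1) : 0 < (1 - x).re := by
  have := (Complex.abs_re_le_norm x).trans_lt hx
  rw [Complex.sub_re, Complex.one_re]
  linarith [(abs_lt.1 this).2]

theorem sub_cos_eq_mul {z : ℂ} (hz : z ∈ cutPlane) (θ : ℂ) :
    z - Complex.cos θ = joukowskyInv z / 2 * ((1 - Complex.exp (θ * Complex.I) / joukowskyInv z) *
      (1 - Complex.exp (-θ * Complex.I) / joukowskyInv z)) := by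
  have h0 := joukowskyInv_ne_zero hz
  have h1 := joukowskyInv_add_inv hz
  have h2 : Complex.exp (θ * Complex.I) * Complex.exp (-θ * Complex.I) = 1 := by
    rw [← Complex.exp_add, ← Complex.exp_zero]
    congr 1
    ring
  have h3 : z = (joukowskyInv z + (joukowskyInv z)⁻¹) / 2 := by rw [h1]; ring
  rw [Complex.cos]
  generalize joukowskyInv z = w at *
  generalize Complex.exp (θ * Complex.I) = u at *
  generalize Complex.exp (-θ * Complex.I) = v at *
  rw [h3]
  field_simp
  linear_combination -h2

theorem subPow_cos_ofReal (ν : ℂ) {z : ℂ} (hz : z ∈ cutPlane) (θ : ℝ) :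
    subPow z (Complex.cos θ) (-ν) =
      (joukowskyInv z / 2) ^ (-ν) * ((1 - Complex.exp (θ * Complex.I) / joukowskyInv z) ^ (-ν) *
        (1 - Complex.exp (-θ * Complex.I) / joukowskyInv z) ^ (-ν)) := by
  have h1 := one_lt_norm_joukowskyInv hz
  have hlog := Real.log_pos h1
  rw [← Complex.ofReal_cos, subPow_ofReal hz ⟨Real.neg_one_le_cos θ, Real.cos_le_one θ⟩]
  refine (sameSide_sub_joukowskyInv hz (Real.cos_le_one θ)).cpow_eq_mul
    (div_ne_zero (joukowskyInv_ne_zero hz) two_ne_zero)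
    (one_sub_re_pos (norm_exp_mul_I_div_lt_one h1 (by simpa using hlog)))
    (one_sub_re_pos (norm_exp_mul_I_div_lt_one h1 (by simpa using hlog))) ?_ _
  rw [Complex.ofReal_cos, sub_cos_eq_mul hz]

/-- Both sides are analytic in `θ` on the strip and agree on the real axis, so the identity theorem
applies. -/
theorem subPow_cos (ν : ℂ) {a : ℝ} {z θ : ℂ} (hz : z ∈ cutPlane) (hza : z ∈ confocalEllipse a)
    (h : |θ.im| < Real.log ‖joukowskyInv z‖) :
    subPow z (Complex.cos θ) (-ν) =
      (joukowskyInv z / 2) ^ (-ν) * ((1 - Complex.exp (θ * Complex.I) / joukowskyInv z) ^ (-ν) *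
        (1 - Complex.exp (-θ * Complex.I) / joukowskyInv z) ^ (-ν)) := by
  have h1 := one_lt_norm_joukowskyInv hz
  set r := Real.log ‖joukowskyInv z‖ with hr
  have hr0 : 0 < r := Real.log_pos h1
  have hU : {θ : ℂ | |θ.im| < r} = Complex.imLm ⁻¹' Set.Ioo (-r) r := by
    ext θ
    simp [abs_lt]
  have hopen : IsOpen {θ : ℂ | |θ.im| < r} := isOpen_lt (by fun_prop) (by fun_prop)
  have hconn : IsPreconnected {θ : ℂ | |θ.im| < r} := by
    rw [hU]
    exact ((convex_Ioo _ _).linear_preimage _).isPreconnected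
  have hf : DifferentiableOn ℂ (fun θ => subPow z (Complex.cos θ) (-ν)) {θ : ℂ | |θ.im| < r} :=
    (differentiableOn_subPow hz hza (-ν)).comp Complex.differentiable_cos.differentiableOn
      fun θ hθ => (cos_mem_confocalEllipseInterior_iff hz hza).2 hθ
  have hg : DifferentiableOn ℂ (fun θ : ℂ => (joukowskyInv z / 2) ^ (-ν) *
      ((1 - Complex.exp (θ * Complex.I) / joukowskyInv z) ^ (-ν) *
        (1 - Complex.exp (-θ * Complex.I) / joukowskyInv z) ^ (-ν))) {θ : ℂ | |θ.im| < r} := by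
    intro θ hθ
    refine DifferentiableAt.differentiableWithinAt (DifferentiableAt.const_mul ?_ _)
    refine DifferentiableAt.mul ?_ ?_
    · exact DifferentiableAt.cpow (by fun_prop) (by fun_prop)
        (Or.inl (one_sub_re_pos (norm_exp_mul_I_div_lt_one h1 hθ)))
    · exact DifferentiableAt.cpow (by fun_prop) (by fun_prop)
        (Or.inl (one_sub_re_pos (norm_exp_mul_I_div_lt_one h1 (by simpa using hθ))))
  refine (hf.analyticOnNhd hopen).eqOn_of_preconnected_of_frequently_eq
    (hg.analyticOnNhd hopen) hconn (z₀ := 0) (by simpa using hr0) ?_ h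
  -- Nonzero real `θ` tending to 0 provide the accumulating points of agreement.
  have ht : Tendsto (fun t : ℝ => (t : ℂ)) (𝓝[≠] 0) (𝓝[≠] 0) := by
    refine tendsto_nhdsWithin_iff.2 ⟨?_, ?_⟩
    · exact (Complex.continuous_ofReal.tendsto' 0 0 (by simp)).mono_left nhdsWithin_le_nhds
    · filter_upwards [self_mem_nhdsWithin] with t ht using by simpa using ht
  exact ht.frequently (Frequently.of_forall fun t => subPow_cos_ofReal ν hz t)

/-- The Chebyshev expansion of `(z - x) ^ (-ν)` at `x = cos θ`. -/
theorem hasSum_cos_chebyshevCoeff (ν : ℂ) {a : ℝ} {z θ : ℂ} (hz : z ∈ cutPlane)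
    (hza : z ∈ confocalEllipse a) (h : Complex.cos θ ∈ confocalEllipseInterior a) :
    HasSum (fun n : ℕ => neumannFactor n * Complex.cos (n * θ) * chebyshevCoeff ν n z)
      (subPow z (Complex.cos θ) (-ν)) := by
  have h1 := (cos_mem_confocalEllipseInterior_iff hz hza).1 h
  rw [subPow_cos ν hz hza h1]
  exact hasSum_cos_chebyshevCoeff_aux ν hz h1

theorem differentiableOn_chebyshevCoeff (ν : ℂ) (n : ℕ) :
    DifferentiableOn ℂ (chebyshevCoeff ν n) cutPlane := by
  have key : ∀ ζ : ℂ, ‖ζ‖ < 1 → DifferentiableAt ℂ (fun ζ : ℂ => ∑' k,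
      negBinomialCoeff ν (n + k) * negBinomialCoeff ν k * ζ ^ (n + k + k)) ζ := by
    intro ζ hζ
    obtain ⟨r, hr1, hr2⟩ := exists_between hζ
    have hr0 : 0 ≤ r := (norm_nonneg _).trans hr1.le
    have hs := summable_norm_negBinomialCoeff ν (x := (r : ℂ)) (by
      rwa [Complex.norm_real, Real.norm_of_nonneg hr0])
    -- The majorant consists of the terms at `(n + k, k)` of the product of two absolutely
    -- convergent binomial series at radius `r`.
    have hu : Summable (fun k => ‖negBinomialCoeff ν (n + k) * (r : ℂ) ^ (n + k)‖ *
        ‖negBinomialCoeff ν k * (r : ℂ) ^ k‖) := by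
      have h2 := hs.mul_of_nonneg hs (fun _ => norm_nonneg _) (fun _ => norm_nonneg _)
      exact h2.comp_injective (i := fun k : ℕ => (n + k, k)) fun k l h => (Prod.ext_iff.1 h).2
    refine (Complex.differentiableOn_tsum_of_summable_norm (U := Metric.ball 0 r) hu
      (fun k => by fun_prop) Metric.isOpen_ball fun k x hx => ?_).differentiableAt
        (Metric.isOpen_ball.mem_nhds (by simpa using hr1))
    have hx' : ‖x‖ ≤ r := by simpa using (mem_ball_zero_iff.1 hx).le
    simp only [norm_mul, norm_pow, Complex.norm_real, Real.norm_of_nonneg hr0]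
    calc _ ≤ ‖negBinomialCoeff ν (n + k)‖ * ‖negBinomialCoeff ν k‖ * r ^ (n + k + k) := by gcongr
      _ = _ := by rw [pow_add]; ring
  have hw := differentiableOn_joukowskyInv
  have e : chebyshevCoeff ν n = fun z => (joukowskyInv z / 2) ^ (-ν) *
      (fun ζ : ℂ => ∑' k, negBinomialCoeff ν (n + k) * negBinomialCoeff ν k * ζ ^ (n + k + k))
        (joukowskyInv z)⁻¹ := by
    funext z
    rw [chebyshevCoeff, tsum_mul_left]
  rw [e]
  intro z hz
  have hd := hw.differentiableAt (isOpen_cutPlane.mem_nhds hz)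
  refine DifferentiableAt.differentiableWithinAt (DifferentiableAt.mul ?_ ?_)
  · exact DifferentiableAt.cpow (hd.div_const 2) (by fun_prop)
      (joukowskyInv_div_two_mem_slitPlane hz)
  · have hn : ‖(joukowskyInv z)⁻¹‖ < 1 := by
      rw [norm_inv]
      exact inv_lt_one_of_one_lt₀ (one_lt_norm_joukowskyInv hz)
    exact DifferentiableAt.comp z (key _ hn) (hd.inv (joukowskyInv_ne_zero hz))

/-! ### The expansion in powers of `1 / z` -/

/-- The terms with `j + k = m` are the binomial expansion of `(cos θ / z)^m = (2z)^{-m}(e^{iθ} +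
e^{-iθ})^m`. Their norms add up to `|negBinomialCoeff ν m| |z|^{-m}`, which gives absolute
summability. -/
theorem hasSum_choose_mul_exp (ν : ℂ) {z : ℂ} (hz1 : 1 < ‖z‖) (θ : ℝ) :
    HasSum (fun p : ℕ × ℕ => negBinomialCoeff ν (p.1 + p.2) * ((p.1 + p.2).choose p.1 : ℂ) *
      (2 * z)⁻¹ ^ (p.1 + p.2) * Complex.exp (((p.1 : ℂ) - p.2) * (θ * Complex.I)))
      ((1 - Complex.cos θ / z) ^ (-ν)) := by
  have hz0 : z ≠ 0 := by rintro rfl; simp at hz1; linarith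
  set F : ℕ × ℕ → ℂ := fun p => negBinomialCoeff ν (p.1 + p.2) * ((p.1 + p.2).choose p.1 : ℂ) *
      (2 * z)⁻¹ ^ (p.1 + p.2) * Complex.exp (((p.1 : ℂ) - p.2) * (θ * Complex.I)) with hF
  have hexp : ∀ x : ℝ, ‖Complex.exp (x * Complex.I)‖ = 1 := Complex.norm_exp_ofReal_mul_I
  have hnorm : ∀ p, ‖F p‖ = ‖negBinomialCoeff ν (p.1 + p.2)‖ * (p.1 + p.2).choose p.1 *
      ‖(2 * z)⁻¹‖ ^ (p.1 + p.2) := by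
    intro p
    have := hexp (((p.1 : ℝ) - p.2) * θ)
    push_cast at this
    simp only [hF, norm_mul, norm_pow, Complex.norm_natCast]
    rw [← mul_assoc, this, mul_one]
  have hinner : ∀ (m : ℕ) (x y : ℂ), ∑ p ∈ Finset.HasAntidiagonal.antidiagonal m,
      ((p.1 + p.2).choose p.1 : ℂ) * (x ^ p.1 * y ^ p.2) = (x + y) ^ m := by
    intro m x y
    rw [(Commute.all x y).add_pow']
    refine Finset.sum_congr rfl fun p hp => ?_
    rw [Finset.HasAntidiagonal.mem_antidiagonal.1 hp, nsmul_eq_mul]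
  have hsum : Summable F := by
    refine Summable.of_norm ?_
    rw [← Finset.HasAntidiagonal.sigmaAntidiagonalEquivProd.summable_iff]
    refine (summable_sigma_of_nonneg (fun _ => norm_nonneg _)).2
      ⟨fun m => (hasSum_fintype _).summable, ?_⟩
    have hs := summable_norm_negBinomialCoeff ν (x := z⁻¹) (by
      rw [norm_inv]; exact inv_lt_one_of_one_lt₀ hz1)
    refine hs.congr fun m => ?_
    rw [tsum_fintype]
    simp only [Finset.HasAntidiagonal.sigmaAntidiagonalEquivProd_apply]
    rw [Finset.sum_coe_sort _ (fun p : ℕ × ℕ => ‖F p‖)]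
    have h2 : ∀ p ∈ Finset.HasAntidiagonal.antidiagonal m,
        ‖F p‖ = ‖negBinomialCoeff ν m‖ * ‖(2 * z)⁻¹‖ ^ m * (p.1 + p.2).choose p.1 := by
      intro p hp
      rw [hnorm, Finset.HasAntidiagonal.mem_antidiagonal.1 hp]
      ring
    rw [Finset.sum_congr rfl h2, ← Finset.mul_sum]
    have h3 := hinner m 1 1
    simp only [one_pow, mul_one, one_add_one_eq_two] at h3
    have h4 : ∑ p ∈ Finset.HasAntidiagonal.antidiagonal m, ((p.1 + p.2).choose p.1 : ℝ) = 2 ^ m := by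
      exact_mod_cast h3
    rw [h4, norm_mul, norm_pow, norm_inv, norm_inv, norm_mul, mul_inv, mul_pow]
    simp only [Complex.norm_ofNat]
    rw [mul_assoc, mul_assoc, mul_comm _ ((2 : ℝ) ^ m), ← mul_assoc ((2 : ℝ)⁻¹ ^ m), ← mul_pow]
    norm_num
  have h1 : HasSum (fun m => ∑ p ∈ Finset.HasAntidiagonal.antidiagonal m, F p) (∑' p, F p) := by
    have h2 := (Finset.HasAntidiagonal.sigmaAntidiagonalEquivProd.hasSum_iff).2 hsum.hasSum
    refine h2.sigma fun m => ?_
    have h3 := hasSum_fintype (fun p : Finset.HasAntidiagonal.antidiagonal m => F p)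
    rwa [Finset.sum_coe_sort _ F] at h3
  have hx : ‖Complex.cos θ / z‖ < 1 := by
    rw [norm_div, div_lt_one (by linarith), ← Complex.ofReal_cos, Complex.norm_real]
    exact (Real.abs_cos_le_one θ).trans_lt hz1
  have h5 : (fun m => ∑ p ∈ Finset.HasAntidiagonal.antidiagonal m, F p) =
      fun m => negBinomialCoeff ν m * (Complex.cos θ / z) ^ m := by
    funext m
    have h2 : ∀ p ∈ Finset.HasAntidiagonal.antidiagonal m,
        F p = negBinomialCoeff ν m * (2 * z)⁻¹ ^ m * (((p.1 + p.2).choose p.1 : ℂ) * (Complex.exp (θ * Complex.I) ^ p.1 *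
          Complex.exp (-θ * Complex.I) ^ p.2)) := by
      intro p hp
      simp only [hF]
      rw [exp_mul_exp_mul_I, Finset.HasAntidiagonal.mem_antidiagonal.1 hp]
      ring
    rw [Finset.sum_congr rfl h2, ← Finset.mul_sum, hinner, mul_assoc, ← mul_pow, Complex.cos]
    congr 2
    field_simp
  rw [h5] at h1
  rw [(hasSum_negBinomialCoeff ν hx).unique h1]
  exact hsum.hasSum

/-- The quadratic transformation: the Chebyshev coefficient as a power series in `1 / z`. -/
theorem chebyshevCoeff_of_one_lt_norm (ν : ℂ) {z : ℂ} (hz : z ∈ cutPlane) (hz1 : 1 < ‖z‖) (n : ℕ) :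
    chebyshevCoeff ν n z = ∑' k, z ^ (-ν) * (negBinomialCoeff ν (n + k + k) *
      ((n + k + k).choose (n + k) : ℂ) * (2 * z)⁻¹ ^ (n + k + k)) := by
  have h1 := one_lt_norm_joukowskyInv hz
  set b : ℕ → ℂ := fun n => ∑' k, z ^ (-ν) * (negBinomialCoeff ν (n + k + k) *
      ((n + k + k).choose (n + k) : ℂ) * (2 * z)⁻¹ ^ (n + k + k)) with hb
  -- Both cosine series sum to `subPow z (cos θ) (-ν)`, so their difference sums to 0 for every real
  -- `θ`.
  have hz' : ∀ θ : ℝ, HasSum (fun n : ℕ => Complex.cos (n * θ) *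
      (neumannFactor n * (chebyshevCoeff ν n z - b n))) 0 := by
    intro θ
    have h2 := hasSum_cos_chebyshevCoeff_aux ν (θ := (θ : ℂ)) hz (by simpa using Real.log_pos h1)
    rw [← subPow_cos_ofReal ν hz θ, subPow] at h2
    have h3 := hasSum_cos_of_symmetric (f := fun p : ℕ × ℕ => z ^ (-ν) *
      (negBinomialCoeff ν (p.1 + p.2) * ((p.1 + p.2).choose p.1 : ℂ) * (2 * z)⁻¹ ^ (p.1 + p.2)))
      (θ := (θ : ℂ)) (S := z ^ (-ν) * (1 - Complex.cos θ / z) ^ (-ν)) (by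
        rintro ⟨j, k⟩
        simp only [Prod.swap]
        rw [add_comm k j, Nat.choose_symm_add]) (by
        refine ((hasSum_choose_mul_exp ν hz1 θ).mul_left (z ^ (-ν))).congr_fun fun p => ?_
        ring)
    have h4 := h2.sub h3
    rw [sub_self] at h4
    refine h4.congr_fun fun n => ?_
    simp only [hb]
    ring
  have h6 := eq_zero_of_hasSum_cos hz' n
  have h7 : neumannFactor n ≠ 0 := by
    rw [neumannFactor]
    split_ifs <;> norm_num
  exact sub_eq_zero.1 ((mul_eq_zero.1 h6).resolve_left h7)

/-! ### Comparison with the hypergeometric expression -/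

theorem ascPochhammer_eval_add (a : ℂ) (m n : ℕ) :
    (ascPochhammer ℂ (m + n)).eval a =
      (ascPochhammer ℂ m).eval a * (ascPochhammer ℂ n).eval (a + m) := by
  rw [← ascPochhammer_mul]
  simp

/-- The duplication formula: factors `a + i` with `i` even and `i` odd are separated and a 2 is
drawn from each. -/
theorem ascPochhammer_eval_add_self (a : ℂ) (k : ℕ) :
    (ascPochhammer ℂ (k + k)).eval a =
      4 ^ k * ((ascPochhammer ℂ k).eval (a / 2) * (ascPochhammer ℂ k).eval ((a + 1) / 2)) := by
  induction k with
  | zero => simp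
  | succ k ih =>
    rw [show k + 1 + (k + 1) = k + k + 1 + 1 by ring, ascPochhammer_succ_eval,
      ascPochhammer_succ_eval, ascPochhammer_succ_eval, ascPochhammer_succ_eval, ih]
    push_cast
    ring

/-- The factorial `(n + 2k)!` cancels, leaving `(ν)_{n+2k} / ((n+k)! k!)`; then `(ν)_{n+2k} = (ν)_n
(ν+n)_{2k}` and duplication yield the `k`-th hypergeometric term. -/
theorem negBinomialCoeff_mul_choose (ν z : ℂ) (n k : ℕ) :
    negBinomialCoeff ν (n + k + k) * ((n + k + k).choose (n + k) : ℂ) * (2 * z)⁻¹ ^ (n + k + k) =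
      (ascPochhammer ℂ n).eval ν / n.factorial * (2 * z)⁻¹ ^ n *
        (((k.factorial : ℂ)⁻¹ * (ascPochhammer ℂ k).eval ((ν + n + 1) / 2) *
          (ascPochhammer ℂ k).eval ((ν + n) / 2) *
          ((ascPochhammer ℂ k).eval ((n : ℂ) + 1))⁻¹) • (1 / z ^ 2) ^ k) := by
  have h1 : ((n.factorial : ℂ)) * (ascPochhammer ℂ k).eval ((n : ℂ) + 1) = (n + k).factorial := by
    have := ascPochhammer_nat_eq_natCast_ascFactorial ℂ (n + 1) k
    push_cast at this
    rw [this]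
    exact_mod_cast Nat.factorial_mul_ascFactorial n k
  have f1 : (n.factorial : ℂ) ≠ 0 := by exact_mod_cast n.factorial_ne_zero
  have f2 : (k.factorial : ℂ) ≠ 0 := by exact_mod_cast k.factorial_ne_zero
  have f3 : ((n + k).factorial : ℂ) ≠ 0 := by exact_mod_cast (n + k).factorial_ne_zero
  have f4 : ((n + k + k).factorial : ℂ) ≠ 0 := by exact_mod_cast (n + k + k).factorial_ne_zero
  have h2 : (ascPochhammer ℂ k).eval ((n : ℂ) + 1) = (n + k).factorial / n.factorial := by
    rw [← h1]
    field_simp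
  have h3 : (2 * z)⁻¹ ^ (n + k + k) = (2 * z)⁻¹ ^ n * ((4 ^ k)⁻¹ * (1 / z ^ 2) ^ k) := by
    rw [add_assoc, pow_add, ← two_mul, pow_mul (2 * z)⁻¹, ← inv_pow, ← mul_pow]
    congr 2
    rw [mul_inv, mul_pow, one_div, inv_pow z]
    norm_num
  have h4 : (4 : ℂ) ^ k ≠ 0 := pow_ne_zero _ (by norm_num)
  rw [h2, h3, negBinomialCoeff, Nat.cast_add_choose, add_assoc n k k, ascPochhammer_eval_add,
    ascPochhammer_eval_add_self, smul_eq_mul]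
  rw [add_assoc] at f4
  generalize (1 / z ^ 2) ^ k = Z
  generalize (2 * z)⁻¹ ^ n = Y
  field_simp

theorem chebyshevCoeff_eq_ordinaryHypergeometric (ν : ℂ) {z : ℂ} (hz : z ∈ cutPlane)
    (hz1 : 1 < ‖z‖) (n : ℕ) :
    chebyshevCoeff ν n z = z ^ (-ν) * ((ascPochhammer ℂ n).eval ν / n.factorial * (2 * z)⁻¹ ^ n) *
      ordinaryHypergeometric ((ν + n + 1) / 2) ((ν + n) / 2) ((n : ℂ) + 1) (1 / z ^ 2) := by
  rw [chebyshevCoeff_of_one_lt_norm ν hz hz1, ordinaryHypergeometric_eq_tsum]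
  simp only [negBinomialCoeff_mul_choose, tsum_mul_left]
  ring

theorem sqSubOnePow_mul_neg {z : ℂ} (hz : z ∈ cutPlane) {s t : ℂ} (h : s + t = 0) :
    sqSubOnePow z s * sqSubOnePow z t = 1 := by
  have h1 := Complex.slitPlane_ne_zero (sub_one_mem_slitPlane hz)
  have h2 := Complex.slitPlane_ne_zero (add_one_mem_slitPlane hz)
  rw [sqSubOnePow, sqSubOnePow, mul_mul_mul_comm, ← Complex.cpow_add _ _ h1,
    ← Complex.cpow_add _ _ h2, h]
  simp

theorem sqrt_pi_div_two_mul_sqrt_two : √(π / 2) * √2 = √π := by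
  rw [← Real.sqrt_mul (by positivity)]
  congr 1
  ring

/-- The factor by which `Q_{n-1/2}^{ν-1/2}(z)` differs from the Chebyshev coefficient. -/
def legendreQFactor (ν z : ℂ) : ℂ :=
  ((√(π / 2) : ℝ) : ℂ) * Complex.exp (Complex.I * π * (ν - 1 / 2)) * Complex.Gamma ν *
    sqSubOnePow z ((ν - 1 / 2) / 2)

/-- This exhibits a continuation, so that `legendreQ` takes its continued value and not its fallback
on all of `cutPlane`. -/
theorem isLegendreQ_chebyshevCoeff {ν : ℂ} (hν : ∀ k : ℕ, ν ≠ -(k : ℂ)) (n : ℕ) :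
    IsLegendreQ ((n : ℂ) - 1 / 2) (ν - 1 / 2)
      (fun z => legendreQFactor ν z * chebyshevCoeff ν n z) := by
  refine ⟨DifferentiableOn.mul ?_ (differentiableOn_chebyshevCoeff ν n), fun z hz hz1 => ?_⟩
  · intro z hz
    refine DifferentiableAt.differentiableWithinAt (DifferentiableAt.const_mul ?_ _)
    refine DifferentiableAt.mul ?_ ?_
    · exact DifferentiableAt.cpow (by fun_prop) (by fun_prop) (sub_one_mem_slitPlane hz)
    · exact DifferentiableAt.cpow (by fun_prop) (by fun_prop) (add_one_mem_slitPlane hz)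
  · have hz0 := ne_zero_of_mem_cutPlane hz
    have e1 : ((n : ℂ) - 1 / 2 + (ν - 1 / 2) + 2) / 2 = (ν + n + 1) / 2 := by ring
    have e2 : ((n : ℂ) - 1 / 2 + (ν - 1 / 2) + 1) = ν + n := by ring
    have e3 : (n : ℂ) - 1 / 2 + 3 / 2 = n + 1 := by ring
    have e4 : (n : ℂ) - 1 / 2 + 1 = n + 1 / 2 := by ring
    have hΓ : Complex.Gamma (ν + n) = Complex.Gamma ν * (ascPochhammer ℂ n).eval ν := by
      rw [← Complex.Gamma_add_nat_div_Gamma_eq ν hν, mul_div_cancel₀ _ (Complex.Gamma_ne_zero hν)]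
    have hp : (2 : ℂ) ^ ((n : ℂ) + 1 / 2) = 2 ^ n * ((√2 : ℝ) : ℂ) := by
      rw [Complex.cpow_add _ _ two_ne_zero, Complex.cpow_natCast, Real.sqrt_eq_rpow,
        Complex.ofReal_cpow (by norm_num)]
      norm_num
    have hπ : ((√π : ℝ) : ℂ) = ((√(π / 2) : ℝ) : ℂ) * ((√2 : ℝ) : ℂ) := by
      rw [← sqrt_pi_div_two_mul_sqrt_two]
      push_cast
      ring
    have h2 : ((√2 : ℝ) : ℂ) ≠ 0 := by
      exact_mod_cast (Real.sqrt_pos.2 two_pos).ne'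
    have hf : (n.factorial : ℂ) ≠ 0 := by exact_mod_cast n.factorial_ne_zero
    have hzν : z ^ ν ≠ 0 := by simp [Complex.cpow_eq_zero_iff, hz0]
    beta_reduce
    rw [legendreQFormula, chebyshevCoeff_eq_ordinaryHypergeometric ν hz hz1, e1, e2, e3, e4, hΓ,
      hp, hπ, Complex.Gamma_nat_eq_factorial, Complex.cpow_add _ _ hz0, Complex.cpow_natCast,
      Complex.cpow_neg, legendreQFactor, inv_pow, mul_pow]
    generalize ordinaryHypergeometric ((ν + n + 1) / 2) ((ν + n) / 2) ((n : ℂ) + 1) (1 / z ^ 2) = H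
    generalize Complex.exp (Complex.I * π * (ν - 1 / 2)) = E
    generalize sqSubOnePow z ((ν - 1 / 2) / 2) = s
    field_simp

theorem legendreQ_eq_mul_chebyshevCoeff {ν : ℂ} (hν : ∀ k : ℕ, ν ≠ -(k : ℂ)) (n : ℕ) {z : ℂ}
    (hz : z ∈ cutPlane) :
    legendreQ ((n : ℂ) - 1 / 2) (ν - 1 / 2) z = legendreQFactor ν z * chebyshevCoeff ν n z :=
  (isLegendreQ_chebyshevCoeff hν n).legendreQ_eq hz

theorem mul_legendreQFactor {ν : ℂ} (hν : ∀ k : ℕ, ν ≠ -(k : ℂ)) {z : ℂ} (hz : z ∈ cutPlane) :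
    ((√(2 / π) : ℝ) : ℂ) * (Complex.exp (-(Complex.I * π * (ν - 1 / 2))) *
      sqSubOnePow z (-ν / 2 + 1 / 4)) / Complex.Gamma ν * legendreQFactor ν z = 1 := by
  have hΓ := Complex.Gamma_ne_zero hν
  have h1 : ((√(2 / π) : ℝ) : ℂ) * ((√(π / 2) : ℝ) : ℂ) = 1 := by
    rw [← Complex.ofReal_mul, ← Real.sqrt_mul (by positivity), div_mul_div_cancel₀ Real.pi_ne_zero,
      div_self two_ne_zero, Real.sqrt_one, Complex.ofReal_one]
  have h2 : Complex.exp (-(Complex.I * π * (ν - 1 / 2))) *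
      Complex.exp (Complex.I * π * (ν - 1 / 2)) = 1 := by
    rw [← Complex.exp_add, neg_add_cancel, Complex.exp_zero]
  have h3 := sqSubOnePow_mul_neg hz (s := -ν / 2 + 1 / 4) (t := (ν - 1 / 2) / 2) (by ring)
  rw [legendreQFactor]
  calc _ = (((√(2 / π) : ℝ) : ℂ) * ((√(π / 2) : ℝ) : ℂ)) *
        (Complex.exp (-(Complex.I * π * (ν - 1 / 2))) * Complex.exp (Complex.I * π * (ν - 1 / 2))) *
        (sqSubOnePow z (-ν / 2 + 1 / 4) * sqSubOnePow z ((ν - 1 / 2) / 2)) *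
        (Complex.Gamma ν / Complex.Gamma ν) := by ring
    _ = 1 := by rw [h1, h2, h3, div_self hΓ]; ring

theorem hasSum_chebyshev_mul_legendreQ {ν : ℂ} (hν : ∀ k : ℕ, ν ≠ -(k : ℂ)) {a : ℝ} {z x : ℂ}
    (hz : z ∈ cutPlane) (hza : z ∈ confocalEllipse a) (hx : x ∈ confocalEllipseInterior a) :
    HasSum (fun n : ℕ => neumannFactor n * (Polynomial.Chebyshev.T ℂ (n : ℤ)).eval x *
      legendreQ ((n : ℂ) - 1 / 2) (ν - 1 / 2) z) (legendreQFactor ν z * subPow z x (-ν)) := by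
  obtain ⟨θ, rfl⟩ := Complex.cos_surjective x
  refine ((hasSum_cos_chebyshevCoeff ν hz hza hx).mul_left (legendreQFactor ν z)).congr_fun
    fun n => ?_
  rw [legendreQ_eq_mul_chebyshevCoeff hν n hz, Polynomial.Chebyshev.T_complex_cos, Int.cast_natCast]
  ring

end

theorem mainTheorem3 :
    (∀ ν : ℂ, (∀ k : ℕ, ν ≠ -(k : ℂ)) →
      ∀ a : ℝ, 1 < a → ∀ z ∈ cutPlane, z ∈ confocalEllipse a →
      ∀ x ∈ confocalEllipseInterior a,
        Summable (fun n : ℕ => neumannFactor n * (Polynomial.Chebyshev.T ℂ (n : ℤ)).eval x *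
          legendreQ ((n : ℂ) - 1 / 2) (ν - 1 / 2) z) ∧
        subPow z x (-ν) =
          ((Real.sqrt (2 / Real.pi) : ℝ) : ℂ) *
              (Complex.exp (-(Complex.I * Real.pi * (ν - 1 / 2))) *
                sqSubOnePow z (-ν / 2 + 1 / 4)) / Complex.Gamma ν *
            ∑' n : ℕ, neumannFactor n * (Polynomial.Chebyshev.T ℂ (n : ℤ)).eval x *
              legendreQ ((n : ℂ) - 1 / 2) (ν - 1 / 2) z) ∧
    (∀ a : ℝ, 1 < a → ∀ z ∈ cutPlane, z ∈ confocalEllipse a →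
      ∀ x ∈ confocalEllipseInterior a,
        subPow z x (-(1 / 2)) =
          ((Real.sqrt 2 / Real.pi : ℝ) : ℂ) *
            ∑' n : ℕ, neumannFactor n * (Polynomial.Chebyshev.T ℂ (n : ℤ)).eval x *
              legendreQ ((n : ℂ) - 1 / 2) 0 z) := by
  refine ⟨fun ν hν a _ z hz hza x hx => ?_, fun a _ z hz hza x hx => ?_⟩
  · have h := hasSum_chebyshev_mul_legendreQ hν hz hza hx
    refine ⟨h.summable, ?_⟩
    rw [h.tsum_eq, ← mul_assoc, mul_legendreQFactor hν hz, one_mul]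
  · have hν : ∀ k : ℕ, (1 / 2 : ℂ) ≠ -(k : ℂ) := by
      intro k hk
      have h := congrArg Complex.re hk
      norm_num at h
      linarith [(Nat.cast_nonneg k : (0 : ℝ) ≤ k)]
    have h := hasSum_chebyshev_mul_legendreQ hν hz hza hx
    have h1 := mul_legendreQFactor hν hz
    -- At `ν = 1/2` the exponential and the power of `z² - 1` are trivial and `Γ(1/2) = √π`, so the
    -- prefactor is `√(2/π)/√π`.
    have hc : ((Real.sqrt 2 / Real.pi : ℝ) : ℂ) = ((Real.sqrt (2 / Real.pi) : ℝ) : ℂ) *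
        (Complex.exp (-(Complex.I * Real.pi * (1 / 2 - 1 / 2))) *
          sqSubOnePow z (-(1 / 2) / 2 + 1 / 4)) / Complex.Gamma (1 / 2) := by
      have e : (-(1 / 2) / 2 + 1 / 4 : ℂ) = 0 := by norm_num
      have hs : Complex.Gamma (1 / 2) = ((Real.sqrt Real.pi : ℝ) : ℂ) := by
        rw [Complex.Gamma_one_half_eq, Real.sqrt_eq_rpow, Complex.ofReal_cpow Real.pi_pos.le]
        norm_num
      rw [e, hs, sqSubOnePow, sub_self, mul_zero, neg_zero, Complex.exp_zero, Complex.cpow_zero,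
        Complex.cpow_zero, mul_one, mul_one, mul_one, ← Complex.ofReal_div, Real.sqrt_div two_pos.le,
        div_div, Real.mul_self_sqrt Real.pi_pos.le]
    rw [sub_self] at h
    rw [h.tsum_eq, ← mul_assoc, hc, h1, one_mul]
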